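/- Let $q$ be an odd prime power, let $n\ge 0$, and let $O(2n+1,q)$ be the orthogonal group of a non-degenerate quadratic form $Q$ on a vector space $V$ of dimension $2n+1$ over the finite field $\mathbb F_q$, that is, the group of all invertible linear maps $g:V\to V$ with $Q(gv)=Q(v)$ for all $v\in V$. Let $Z_n(g)=|\{v\in V: gv=v\}|$ be the number of vectors (the zero vector included) fixed by $g$, where $g$ is a uniformly distributed random element of $O(2n+1,q)$. Then for all natural numbers $j$ and all $n\ge j$, $$\mathbb E\big[Z_n^{\,j}\big]=\frac{1}{|O(2n+1,q)|}\sum_{g\in O(2n+1,q)} Z_n(g)^j=\prod_{i=1}^{j}(q^i+1).$$ -/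

import Mathlib

open scoped BigOperators

namespace FixedVectors

/-- The orthogonal group of a quadratic form `Q` on `V`: the invertible linear maps of `V`
that preserve `Q`. -/
def orthogonalGroup {F V : Type*} [Field F] [AddCommGroup V] [Module F V]
    (Q : QuadraticForm F V) : Subgroup (V ≃ₗ[F] V) where
  carrier := {g | ∀ v : V, Q (g v) = Q v}
  one_mem' := fun _ => rfl
  mul_mem' := by
    intro a b ha hb v
    rw [LinearEquiv.mul_apply, ha, hb]
  inv_mem' := by
    intro a ha v
    have h := ha (a⁻¹ v)
    rw [← LinearEquiv.mul_apply, mul_inv_cancel, LinearEquiv.coe_one, id] at h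
    exact h.symm

instance finite_orthogonalGroup {F V : Type*} [Field F] [AddCommGroup V] [Module F V]
    [Finite F] [FiniteDimensional F V] (Q : QuadraticForm F V) :
    Finite (orthogonalGroup Q) := by
  haveI : Finite V := Module.finite_of_finite F
  haveI : Finite (V ≃ₗ[F] V) := Finite.of_injective _ DFunLike.coe_injective
  infer_instance

/-- The number of vectors of `V` (the zero vector included) fixed by `g`, for `g` in the
orthogonal group in its natural action on `V`. -/
noncomputable def numFixedVectors {F V : Type*} [Field F] [AddCommGroup V] [Module F V]
    (Q : QuadraticForm F V) (g : orthogonalGroup Q) : ℕ :=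
  Nat.card {v : V // (g : V ≃ₗ[F] V) v = v}

/-- The expected value of `X ω`, for `ω` uniformly distributed on the finite type `Ω`. -/
noncomputable def uniformExpectation {Ω : Type*} [Finite Ω] (X : Ω → ℝ) : ℝ :=
  letI : Fintype Ω := Fintype.ofFinite Ω
  (∑ ω : Ω, X ω) / (Fintype.card Ω : ℝ)

end FixedVectors

namespace FixedVectors

open QuadraticMap Module

/-! ### Isometries and Witt extension -/

section Isometries

variable {F V : Type*} [Field F] [AddCommGroup V] [Module F V] {Q : QuadraticForm F V}

/-! Since Z(g)^j counts the j-tuples fixed by g, its sum over the group is the sum over tuples of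
|G_W|, where G_W is the pointwise stabilizer of the span W. Adjoin one vector x at a time. By
Burnside for G_W acting on V, the orders |G_{W+⟨x⟩}| sum to |G_W| times the number of orbits. Each
vector of W is an orbit. An orbit outside W is determined by the functional that x induces on W and
by Q x (`exists_smul_eq_of_polar_eq`), and every such pair occurs if 2 dim W + 3 ≤ dim V
(`exists_notMem_polar_eq`). So with d = dim W there are q^d + q^(d+1) orbits. As this depends on d,
tuples are weighted by t^d: one step then gives a factor qt + 1 and replaces t by qt
(`sum_card_pointwiseStabilizer_sup`), whence the product. -/

lemma isSymm_polarBilin (Q : QuadraticForm F V) : LinearMap.BilinForm.IsSymm Q.polarBilin :=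
  ⟨fun x y => polar_comm Q x y⟩

lemma mem_orthogonal_polarBilin {W : Submodule F V} {x : V} :
    x ∈ LinearMap.BilinForm.orthogonal Q.polarBilin W ↔ ∀ w ∈ W, polar Q w x = 0 := Iff.rfl

lemma map_add_smul (Q : QuadraticForm F V) (x y : V) (a : F) :
    Q (x + a • y) = Q x + a * a * Q y + a * polar Q x y := by
  rw [QuadraticMap.map_add Q, QuadraticMap.map_smul, polar_smul_right, smul_eq_mul, smul_eq_mul]

lemma polar_self_eq (Q : QuadraticForm F V) (x : V) : polar Q x x = 2 * Q x := by
  rw [polar_self, two_nsmul, two_mul]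

lemma polar_map_of_isometry {f : V →ₗ[F] V} (hf : ∀ v, Q (f v) = Q v) (x y : V) :
    polar Q (f x) (f y) = polar Q x y := by
  simp only [polar, ← map_add, hf]

variable [FiniteDimensional F V]

lemma exists_orthogonalGroup_of_isometry (hQ : Q.polarBilin.Nondegenerate) {f : V →ₗ[F] V}
    (hf : ∀ v, Q (f v) = Q v) : ∃ g : orthogonalGroup Q, ∀ v, g • v = f v := by
  have hinj : Function.Injective f := by
    rw [← LinearMap.ker_eq_bot, LinearMap.ker_eq_bot']
    intro x hx
    refine hQ.1 x fun y => ?_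
    rw [polarBilin_apply_apply, ← polar_map_of_isometry hf, hx, polar_zero_left]
  exact ⟨⟨LinearEquiv.ofInjectiveEndo f hinj, hf⟩, fun _ => rfl⟩

lemma exists_reflection (hQ : Q.polarBilin.Nondegenerate) {d : V} (hd : Q d ≠ 0) :
    ∃ g : orthogonalGroup Q, ∀ v, g • v = v - (polar Q v d / Q d) • d := by
  refine exists_orthogonalGroup_of_isometry hQ
    (f := LinearMap.id - ((Q d)⁻¹ • Q.polarBilin.flip d).smulRight d) (fun v => ?_) |>.imp
    fun g hg v => ?_
  · have h := map_add_smul Q v d (-((Q d)⁻¹ * polar Q v d))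
    rw [neg_smul, ← sub_eq_add_neg] at h
    change Q (v - ((Q d)⁻¹ * polar Q v d) • d) = Q v
    rw [h]
    field_simp
    ring
  · rw [hg, div_eq_inv_mul]
    rfl

/-- Siegel (Eichler) transformations. -/
lemma exists_siegel (hQ : Q.polarBilin.Nondegenerate) {d z : V} (hd : Q d = 0)
    (hdz : polar Q d z = 0) :
    ∃ g : orthogonalGroup Q, ∀ v, g • v =
      v + (polar Q v z - Q z * polar Q v d) • d + (-polar Q v d) • z := by
  refine exists_orthogonalGroup_of_isometry hQ
    (f := LinearMap.id + (Q.polarBilin.flip z - Q z • Q.polarBilin.flip d).smulRight d +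
      (-Q.polarBilin.flip d).smulRight z) (fun v => ?_) |>.imp fun g hg v => ?_
  · change Q (v + (polar Q v z - Q z * polar Q v d) • d + (-polar Q v d) • z) = Q v
    rw [map_add_smul, map_add_smul, polar_add_left, polar_smul_left, hd, hdz, smul_zero]
    ring
  · rw [hg]
    rfl

lemma exists_polar_eq_one_of_notMem (hQ : Q.polarBilin.Nondegenerate) {W : Submodule F V} {x : V}
    (hx : x ∉ W) : ∃ z, (∀ w ∈ W, polar Q w z = 0) ∧ polar Q x z = 1 := by
  rw [← LinearMap.BilinForm.orthogonal_orthogonal hQ (isSymm_polarBilin Q).isRefl W,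
    mem_orthogonal_polarBilin] at hx
  push Not at hx
  obtain ⟨z, hz, hzx⟩ := hx
  refine ⟨(polar Q z x)⁻¹ • z, fun w hw => ?_, ?_⟩
  · rw [polar_smul_right, mem_orthogonal_polarBilin.1 hz w hw, smul_zero]
  · rw [polar_smul_right, polar_comm Q x, smul_eq_mul, inv_mul_cancel₀ hzx]

/-- Reflection in the difference of two vectors of equal length. -/
lemma exists_smul_eq_of_map_sub_ne_zero (hQ : Q.polarBilin.Nondegenerate) {x y : V}
    (hxy : Q x = Q y) (hd : Q (y - x) ≠ 0) :
    ∃ g : orthogonalGroup Q, g • x = y ∧ ∀ w, polar Q w x = polar Q w y → g • w = w := by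
  obtain ⟨g, hg⟩ := exists_reflection hQ hd
  refine ⟨g, ?_, fun w hw => ?_⟩
  · have h : polar Q x (y - x) = -Q (y - x) := by
      have h1 := QuadraticMap.map_add Q x (y - x)
      rw [add_sub_cancel, hxy] at h1
      linear_combination -h1
    rw [hg, h, neg_div, div_self hd, neg_smul, one_smul]
    abel
  · rw [hg, polar_sub_right, hw, sub_self, zero_div, zero_smul, sub_zero]

/-- A case of Witt's extension theorem. -/
theorem exists_smul_eq_of_polar_eq (hQ : Q.polarBilin.Nondegenerate) {W : Submodule F V}
    {x y : V} (hx : x ∉ W) (hy : y ∉ W) (hxy : Q x = Q y)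
    (hW : ∀ w ∈ W, polar Q w x = polar Q w y) :
    ∃ g : orthogonalGroup Q, g • x = y ∧ ∀ w ∈ W, g • w = w := by
  by_cases hd : Q (y - x) = 0
  swap
  · obtain ⟨g, h1, h2⟩ := exists_smul_eq_of_map_sub_ne_zero hQ hxy hd
    exact ⟨g, h1, fun w hw => h2 w (hW w hw)⟩
  obtain ⟨d, rfl⟩ : ∃ d, y = x + d := ⟨y - x, by abel⟩
  rw [add_sub_cancel_left] at hd
  have hWd : ∀ w ∈ W, polar Q w d = 0 := fun w hw => by
    have := hW w hw
    rw [polar_add_right] at this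
    linear_combination -this
  have hxd : polar Q x d = 0 := by
    have := QuadraticMap.map_add Q x d
    linear_combination -this - hxy - hd
  have hdd : polar Q d d = 0 := by rw [polar_self_eq, hd, mul_zero]
  -- Now d is isotropic and orthogonal to W and x. If x lies outside W + ⟨d⟩, a Siegel
  -- transformation adds d to x and fixes W.
  by_cases hmem : x ∈ W ⊔ Submodule.span F {d}
  swap
  · obtain ⟨z, hz, hxz⟩ := exists_polar_eq_one_of_notMem hQ hmem
    have hdz : polar Q d z = 0 :=
      hz d (Submodule.mem_sup_right (Submodule.mem_span_singleton_self d))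
    obtain ⟨g, hg⟩ := exists_siegel hQ hd hdz
    refine ⟨g, ?_, fun w hw => ?_⟩
    · rw [hg, hxd, hxz]
      simp
    · rw [hg, hWd w hw, hz w (Submodule.mem_sup_left hw)]
      simp
  -- Here x = w₀ + a d and y = w₀ + (a+1) d. Two reflections pass through w₀ + a f, with f an
  -- isotropic partner of d orthogonal to W; both differences are anisotropic because a and a + 1
  -- are nonzero.
  obtain ⟨w₀, hw₀, u, hu, rfl⟩ := Submodule.mem_sup.1 hmem
  obtain ⟨a, rfl⟩ := Submodule.mem_span_singleton.1 hu
  have ha : a ≠ 0 := by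
    rintro rfl
    exact hx (by simpa using hw₀)
  have ha1 : a + 1 ≠ 0 := by
    intro h
    refine hy ?_
    rw [add_assoc, show a • d + d = (a + 1) • d by rw [add_smul, one_smul], h, zero_smul, add_zero]
    exact hw₀
  have hdW : d ∉ W := fun h => hx (W.add_mem hw₀ (W.smul_mem a h))
  obtain ⟨z, hz, hdz⟩ := exists_polar_eq_one_of_notMem hQ hdW
  obtain ⟨f, hf, hdf, hf0⟩ : ∃ f, (∀ w ∈ W, polar Q w f = 0) ∧ polar Q d f = 1 ∧ Q f = 0 := by
    refine ⟨z + (-Q z) • d, fun w hw => ?_, ?_, ?_⟩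
    · rw [polar_add_right, polar_smul_right, hz w hw, hWd w hw]
      simp
    · rw [polar_add_right, polar_smul_right, hdz, hdd]
      simp
    · rw [map_add_smul, hd, polar_comm, hdz]
      ring
  have hw₀d := hWd w₀ hw₀
  have hw₀f := hf w₀ hw₀
  have key : ∀ b c : F, b ≠ 0 → c ≠ 0 → Q (w₀ + b • d) = Q (w₀ + c • f) ∧
      Q (w₀ + c • f - (w₀ + b • d)) = -(b * c) := fun b c hb hc => by
    constructor
    · rw [map_add_smul, map_add_smul, hd, hf0, hw₀d, hw₀f]
      ring
    · rw [add_sub_add_left_eq_sub, sub_eq_add_neg, ← neg_smul, map_add_smul,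
        QuadraticMap.map_smul, polar_smul_left, polar_comm, hdf, hf0, hd]
      simp [mul_comm]
  obtain ⟨h1, h2⟩ := key a a ha ha
  obtain ⟨g, hg, hgW⟩ := exists_smul_eq_of_map_sub_ne_zero hQ h1
    (by rw [h2]; exact neg_ne_zero.2 (mul_ne_zero ha ha))
  obtain ⟨h3, h4⟩ := key (a + 1) a ha1 ha
  obtain ⟨g', hg', hgW'⟩ := exists_smul_eq_of_map_sub_ne_zero hQ h3.symm
    (by rw [← neg_sub, QuadraticMap.map_neg, h4]; exact neg_ne_zero.2 (mul_ne_zero ha1 ha))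
  refine ⟨g' * g, ?_, fun w hw => ?_⟩
  · rw [mul_smul, hg, hg', add_smul, one_smul, add_assoc]
  · have hwd := hWd w hw
    have hwf := hf w hw
    rw [mul_smul, hgW, hgW'] <;> simp [polar_add_right, hwd, hwf]

end Isometries

/-! ### Vectors with prescribed products with W and prescribed norm -/

section Existence

variable {F V : Type*} [Field F] [AddCommGroup V] [Module F V] [FiniteDimensional F V]
  {Q : QuadraticForm F V}

/-- In an orthogonal basis of W^⊥, the isotropic members lie in W^⊥⊥ = W, so there are at most dim W
of them; dim W^⊥ ≥ dim W + 3 leaves three others. -/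
lemma exists_orthogonal_anisotropic_triple (h2 : (2 : F) ≠ 0) (hQ : Q.polarBilin.Nondegenerate)
    {W : Submodule F V} (hW : 2 * finrank F W + 3 ≤ finrank F V) :
    ∃ e : Fin 3 → V, (∀ i, ∀ w ∈ W, polar Q w (e i) = 0) ∧ (∀ i, Q (e i) ≠ 0) ∧
      ∀ i k, i ≠ k → polar Q (e i) (e k) = 0 := by
  classical
  let U := LinearMap.BilinForm.orthogonal Q.polarBilin W
  have hU : finrank F U = finrank F V - finrank F W :=
    LinearMap.BilinForm.finrank_orthogonal hQ W
  have : Invertible (2 : F) := invertibleOfNonzero h2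
  obtain ⟨v, hv⟩ := LinearMap.BilinForm.exists_orthogonal_basis
    (B := LinearMap.BilinForm.restrict Q.polarBilin U) ⟨fun x y => polar_comm Q x y⟩
  have hv' : ∀ i k, i ≠ k → polar Q (v i : V) (v k) = 0 := fun i k hik => hv hik
  let S : Finset (Fin (finrank F U)) := Finset.univ.filter fun i => Q (v i) = 0
  have hS : S.card ≤ finrank F W := by
    have hmem : ∀ i : S, (v i : V) ∈ W := by
      rintro ⟨i, hi⟩
      have hi0 : Q (v i) = 0 := (Finset.mem_filter.1 hi).2
      rw [← LinearMap.BilinForm.orthogonal_orthogonal hQ (isSymm_polarBilin Q).isRefl W]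
      intro u hu
      change polar Q u (v i) = 0
      have : (Q.polarBilin.flip (v i)) ∘ₗ U.subtype = 0 := by
        refine v.ext fun k => ?_
        change polar Q (v k : V) (v i) = 0
        by_cases hik : k = i
        · rw [hik, polar_self_eq, hi0, mul_zero]
        · exact hv' k i hik
      exact LinearMap.congr_fun this ⟨u, hu⟩
    have hli : LinearIndependent F fun i : S => (⟨v i, hmem i⟩ : W) := by
      refine LinearIndependent.of_comp W.subtype ?_
      exact (v.linearIndependent.map' U.subtype (Submodule.ker_subtype U)).comp _
        Subtype.val_injective
    simpa using hli.fintype_card_le_finrank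
  have hcard : 2 < Sᶜ.card := by
    rw [Finset.card_compl, Fintype.card_fin]
    omega
  obtain ⟨a, ha, b, hb, c, hc, hab, hac, hbc⟩ := Finset.two_lt_card.1 hcard
  have hne : ∀ i ∈ Sᶜ, Q (v i) ≠ 0 := fun i hi => by simpa [S] using hi
  refine ⟨![v a, v b, v c], fun i w hw => ?_, fun i => ?_, fun i k hik => ?_⟩
  · fin_cases i
    exacts [(v a).2 w hw, (v b).2 w hw, (v c).2 w hw]
  · fin_cases i
    exacts [hne a ha, hne b hb, hne c hc]
  · fin_cases i <;> fin_cases k <;> first | exact absurd rfl hik | skip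
    exacts [hv' _ _ hab, hv' _ _ hac, hv' _ _ hab.symm, hv' _ _ hbc, hv' _ _ hac.symm,
      hv' _ _ hbc.symm]

open Polynomial in
lemma exists_add_quadratic_eq [Finite F] (hF : Odd (Nat.card F)) {a b : F} (ha : a ≠ 0)
    (hb : b ≠ 0) (r s c : F) : ∃ x y : F, a * x ^ 2 + r * x + (b * y ^ 2 + s * y) = c := by
  have := Fintype.ofFinite F
  obtain ⟨x, y, h⟩ := FiniteField.exists_root_sum_quadratic (degree_quadratic ha (b := r) (c := 0))
    (degree_quadratic hb (b := s) (c := -c))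
    (by rw [← Nat.card_eq_fintype_card]; exact Nat.odd_iff.1 hF)
  refine ⟨x, y, ?_⟩
  simp only [eval_add, eval_mul, eval_C, eval_pow, eval_X] at h
  linear_combination h

theorem exists_notMem_polar_eq [Finite F] (hF : Odd (Nat.card F)) (h2 : (2 : F) ≠ 0)
    (hQ : Q.polarBilin.Nondegenerate) {W : Submodule F V}
    (hW : 2 * finrank F W + 3 ≤ finrank F V) (φ : Dual F W) (c : F) :
    ∃ x, x ∉ W ∧ (∀ w : W, polar Q w x = φ w) ∧ Q x = c := by
  obtain ⟨e, heW, he, hee⟩ := exists_orthogonal_anisotropic_triple h2 hQ hW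
  obtain ⟨ψ, hψ⟩ := φ.exists_extend
  obtain ⟨x₀, hx₀⟩ : ∃ x₀, ∀ v, polar Q x₀ v = ψ v :=
    ⟨(LinearMap.BilinForm.toDual Q.polarBilin hQ).symm ψ, fun v =>
      LinearMap.BilinForm.apply_toDual_symm_apply (hB := hQ) ψ v⟩
  -- This makes the product of x with e 2 equal to 1, which keeps x out of W since e 2 ⊥ W. The
  -- coordinates along e 0 and e 1 remain free to adjust Q x.
  let t : F := (1 - polar Q x₀ (e 2)) / (2 * Q (e 2))
  obtain ⟨r, s, hrs⟩ := exists_add_quadratic_eq hF (he 0) (he 1) (polar Q x₀ (e 0))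
    (polar Q x₀ (e 1)) (c - Q x₀ - t * t * Q (e 2) - t * polar Q x₀ (e 2))
  have h01 := hee 0 1 (by decide)
  have h02 := hee 0 2 (by decide)
  have h12 := hee 1 2 (by decide)
  refine ⟨x₀ + r • e 0 + s • e 1 + t • e 2, fun hmem => ?_, fun w => ?_, ?_⟩
  · have h := heW 2 _ hmem
    simp only [polar_add_left, polar_smul_left, h02, h12, polar_self_eq, smul_eq_mul] at h
    have ht : t * (2 * Q (e 2)) = 1 - polar Q x₀ (e 2) :=
      div_mul_cancel₀ _ (mul_ne_zero h2 (he 2))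
    exact one_ne_zero (α := F) (by linear_combination h - ht)
  · have h : ψ w = φ w := LinearMap.congr_fun hψ w
    simp only [polar_add_right, polar_smul_right, heW _ w w.2, smul_zero, add_zero]
    rw [polar_comm, hx₀, h]
  · simp only [map_add_smul, polar_add_left, polar_smul_left, h01, h02, h12, smul_eq_mul]
    linear_combination hrs

end Existence

/-- Burnside's lemma, counting the pairs (g, x) with g x = x by x. -/
lemma sum_card_stabilizer {G X : Type*} [Group G] [MulAction G X] [Finite G] [Fintype X] :
    ∑ x : X, Nat.card (MulAction.stabilizer G x) =
      Nat.card (MulAction.orbitRel.Quotient G X) * Nat.card G := by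
  rw [← Nat.card_prod, ← Nat.card_congr (MulAction.sigmaFixedByEquivOrbitsProdGroup G X),
    ← Nat.card_sigma]
  exact Nat.card_congr
    { toFun := fun p => ⟨p.2, p.1, p.2.2⟩
      invFun := fun p => ⟨p.2, p.1, p.2.2⟩
      left_inv := fun _ => rfl
      right_inv := fun _ => rfl }

lemma prod_Icc_one_eq_prod_range {M : Type*} [CommMonoid M] (f : ℕ → M) (n : ℕ) :
    ∏ i ∈ Finset.Icc 1 n, f i = ∏ i ∈ Finset.range n, f (i + 1) := by
  induction n with
  | zero => simp
  | succ n ih => rw [Finset.prod_Icc_succ_top (by omega), Finset.prod_range_succ, ih]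

/-! ### Orbits of pointwise stabilizers and the weighted count -/

section Orbits

variable {F V : Type*} [Field F] [AddCommGroup V] [Module F V]

/-- The pointwise stabilizer of the subspace `W` in the orthogonal group. -/
abbrev pointwiseStabilizer (Q : QuadraticForm F V) (W : Submodule F V) :
    Subgroup (orthogonalGroup Q) :=
  fixingSubgroup (orthogonalGroup Q) (W : Set V)

variable {Q : QuadraticForm F V}

lemma mem_pointwiseStabilizer {W : Submodule F V} {g : orthogonalGroup Q} :
    g ∈ pointwiseStabilizer Q W ↔ ∀ w ∈ W, g • w = w :=
  mem_fixingSubgroup_iff _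

lemma mem_pointwiseStabilizer_span {s : Set V} {g : orthogonalGroup Q} :
    g ∈ pointwiseStabilizer Q (Submodule.span F s) ↔ ∀ w ∈ s, g • w = w := by
  rw [mem_pointwiseStabilizer]
  refine ⟨fun h w hw => h w (Submodule.subset_span hw), fun h w hw => ?_⟩
  exact LinearMap.eqOn_span (f := ((g : V ≃ₗ[F] V) : V →ₗ[F] V)) (g := LinearMap.id) h hw

lemma card_stabilizer_pointwiseStabilizer (W : Submodule F V) (x : V) :
    Nat.card (MulAction.stabilizer (pointwiseStabilizer Q W) x) =
      Nat.card (pointwiseStabilizer Q (W ⊔ Submodule.span F {x})) := by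
  have key : ∀ g : orthogonalGroup Q, g ∈ pointwiseStabilizer Q (W ⊔ Submodule.span F {x}) ↔
      g ∈ pointwiseStabilizer Q W ∧ g • x = x := fun g => by
    rw [← Submodule.span_eq W, ← Submodule.span_union, mem_pointwiseStabilizer_span,
      mem_pointwiseStabilizer_span]
    simp [or_imp, forall_and, and_comm]
  exact Nat.card_congr
    { toFun := fun g => ⟨g.1.1, (key _).2 ⟨g.1.2, g.2⟩⟩
      invFun := fun g => ⟨⟨g.1, ((key _).1 g.2).1⟩, ((key _).1 g.2).2⟩
      left_inv := fun _ => rfl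
      right_inv := fun _ => rfl }

open Classical in
/-- The complete invariant of a vector under the pointwise stabilizer of `W`. -/
noncomputable def orbitInvariant (Q : QuadraticForm F V) (W : Submodule F V) (x : V) :
    W ⊕ (Dual F W × F) :=
  if h : x ∈ W then Sum.inl ⟨x, h⟩ else Sum.inr ((Q.polarBilin.flip x).comp W.subtype, Q x)

lemma orbitInvariant_smul {W : Submodule F V} {g : orthogonalGroup Q}
    (hg : g ∈ pointwiseStabilizer Q W) (x : V) :
    orbitInvariant Q W (g • x) = orbitInvariant Q W x := by
  have hfix := mem_pointwiseStabilizer.1 hg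
  by_cases hx : x ∈ W
  · rw [hfix x hx]
  · have hgx : g • x ∉ W := fun h => hx <| by
      have := mem_pointwiseStabilizer.1 (inv_mem hg) _ h
      rw [inv_smul_smul] at this
      rwa [this]
    rw [orbitInvariant, orbitInvariant, dif_neg hx, dif_neg hgx]
    congr 2
    · ext w
      change polar Q w (g • x) = polar Q w x
      conv_lhs => rw [← hfix w w.2]
      exact polar_map_of_isometry (f := ((g : V ≃ₗ[F] V) : V →ₗ[F] V)) g.2 w x
    · exact g.2 x

variable [FiniteDimensional F V]

lemma exists_smul_eq_of_orbitInvariant_eq (hQ : Q.polarBilin.Nondegenerate) {W : Submodule F V}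
    {x y : V} (h : orbitInvariant Q W x = orbitInvariant Q W y) :
    ∃ g ∈ pointwiseStabilizer Q W, g • x = y := by
  unfold orbitInvariant at h
  split_ifs at h with hx hy hy
  · exact ⟨1, one_mem _, by simpa using h⟩
  · obtain ⟨h1, h2⟩ := Prod.ext_iff.1 (Sum.inr_injective h)
    obtain ⟨g, hg, hgW⟩ := exists_smul_eq_of_polar_eq hQ hx hy h2
      fun w hw => LinearMap.congr_fun h1 ⟨w, hw⟩
    exact ⟨g, mem_pointwiseStabilizer.2 hgW, hg⟩

variable [Finite F]

lemma two_ne_zero_of_odd_card (hF : Odd (Nat.card F)) : (2 : F) ≠ 0 := by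
  have := Fintype.ofFinite F
  refine Ring.two_ne_zero fun h => ?_
  have := FiniteField.even_card_of_char_two h
  rw [← Nat.card_eq_fintype_card] at this
  have := Nat.odd_iff.1 hF
  omega

lemma orbitInvariant_surjective (hF : Odd (Nat.card F)) (hQ : Q.polarBilin.Nondegenerate)
    {W : Submodule F V} (hW : 2 * finrank F W + 3 ≤ finrank F V) :
    Function.Surjective (orbitInvariant Q W) := by
  rintro (w | ⟨φ, c⟩)
  · exact ⟨w, dif_pos w.2⟩
  · obtain ⟨x, hx, hφ, hc⟩ :=
      exists_notMem_polar_eq hF (two_ne_zero_of_odd_card hF) hQ hW φ c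
    refine ⟨x, (dif_neg hx).trans ?_⟩
    rw [hc]
    congr 2
    ext w
    exact hφ w

lemma card_orbits_pointwiseStabilizer (hF : Odd (Nat.card F)) (hQ : Q.polarBilin.Nondegenerate)
    {W : Submodule F V} (hW : 2 * finrank F W + 3 ≤ finrank F V) :
    Nat.card (MulAction.orbitRel.Quotient (pointwiseStabilizer Q W) V) =
      Nat.card F ^ finrank F W + Nat.card F ^ (finrank F W + 1) := by
  have : Finite V := Module.finite_of_finite F
  have : Finite (Dual F W) := Module.finite_of_finite F
  let Ψ : MulAction.orbitRel.Quotient (pointwiseStabilizer Q W) V → W ⊕ (Dual F W × F) :=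
    Quotient.lift (orbitInvariant Q W) <| by
      rintro _ y ⟨g, rfl⟩
      exact orbitInvariant_smul g.2 y
  have hΨ : Function.Bijective Ψ := by
    constructor
    · rintro ⟨x⟩ ⟨y⟩ h
      obtain ⟨g, hg, hgx⟩ := exists_smul_eq_of_orbitInvariant_eq hQ (x := y) (y := x) h.symm
      exact Quotient.sound ⟨⟨g, hg⟩, hgx⟩
    · intro z
      obtain ⟨x, hx⟩ := orbitInvariant_surjective hF hQ hW z
      exact ⟨Quotient.mk _ x, hx⟩
  rw [Nat.card_congr (Equiv.ofBijective Ψ hΨ), Nat.card_sum, Nat.card_prod,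
    Module.natCard_eq_pow_finrank (K := F) (V := W),
    Module.natCard_eq_pow_finrank (K := F) (V := Dual F W), Subspace.dual_finrank_eq, pow_succ]

-- Burnside gives the unweighted sum over all x. Vectors of W leave the span unchanged, so
-- subtraction gives the sum outside W, where the weight is constantly t^(dim W + 1).
open Classical in
theorem sum_card_pointwiseStabilizer_sup [Fintype V] (hF : Odd (Nat.card F))
    (hQ : Q.polarBilin.Nondegenerate) {W : Submodule F V}
    (hW : 2 * finrank F W + 3 ≤ finrank F V) (t : ℕ) :
    ∑ x : V, Nat.card (pointwiseStabilizer Q (W ⊔ Submodule.span F {x})) *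
        t ^ finrank F (W ⊔ Submodule.span F {x} : Submodule F V) =
      (Nat.card F * t + 1) *
        (Nat.card (pointwiseStabilizer Q W) * (Nat.card F * t) ^ finrank F W) := by
  have hsup : ∀ x ∈ W, W ⊔ Submodule.span F {x} = W := fun x hx =>
    sup_eq_left.2 ((Submodule.span_singleton_le_iff_mem _ _).2 hx)
  have hfin : ∀ x ∉ W, finrank F (W ⊔ Submodule.span F {x} : Submodule F V) = finrank F W + 1 :=
    fun x hx => by
      have h := Submodule.finrank_sup_add_finrank_inf_eq W (Submodule.span F {x})
      have h0 : W ⊓ Submodule.span F {x} = ⊥ :=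
        ((Submodule.disjoint_span_singleton_of_notMem hx)).eq_bot
      rwa [h0, finrank_bot, finrank_span_singleton (ne_of_mem_of_not_mem W.zero_mem hx).symm] at h
  have hcardW : (Finset.univ.filter (· ∈ W)).card = Nat.card F ^ finrank F W := by
    rw [← Module.natCard_eq_pow_finrank (K := F) (V := W), Nat.card_eq_fintype_card, Fintype.card_subtype]
  have hin : ∀ f : ℕ → ℕ, ∑ x with x ∈ W, Nat.card (pointwiseStabilizer Q
      (W ⊔ Submodule.span F {x})) * f (finrank F (W ⊔ Submodule.span F {x} : Submodule F V)) =
      Nat.card F ^ finrank F W * (Nat.card (pointwiseStabilizer Q W) * f (finrank F W)) :=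
    fun f => by
      rw [← hcardW, ← smul_eq_mul, ← Finset.sum_const]
      refine Finset.sum_congr rfl fun x hx => ?_
      rw [hsup x (Finset.mem_filter.1 hx).2]
  have htotal : ∑ x : V, Nat.card (pointwiseStabilizer Q (W ⊔ Submodule.span F {x})) =
      (Nat.card F ^ finrank F W + Nat.card F ^ (finrank F W + 1)) *
        Nat.card (pointwiseStabilizer Q W) := by
    rw [← card_orbits_pointwiseStabilizer hF hQ hW, ← sum_card_stabilizer]
    exact Finset.sum_congr rfl fun x _ => (card_stabilizer_pointwiseStabilizer W x).symm
  have hout : ∑ x with x ∉ W, Nat.card (pointwiseStabilizer Q (W ⊔ Submodule.span F {x})) =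
      Nat.card F ^ (finrank F W + 1) * Nat.card (pointwiseStabilizer Q W) := by
    have h := hin fun _ => 1
    simp only [mul_one] at h
    rw [← Finset.sum_filter_add_sum_filter_not _ (· ∈ W), h, add_mul] at htotal
    exact Nat.add_left_cancel htotal
  rw [← Finset.sum_filter_add_sum_filter_not _ (· ∈ W), hin (t ^ ·),
    Finset.sum_congr rfl fun x hx => by rw [hfin x (Finset.mem_filter.1 hx).2],
    ← Finset.sum_mul, hout]
  ring

theorem sum_card_pointwiseStabilizer_span_range [Fintype V] (hF : Odd (Nat.card F))
    (hQ : Q.polarBilin.Nondegenerate) (j : ℕ) (hj : 2 * j + 1 ≤ finrank F V) (t : ℕ) :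
    ∑ v : Fin j → V, Nat.card (pointwiseStabilizer Q (Submodule.span F (Set.range v))) *
        t ^ finrank F (Submodule.span F (Set.range v)) =
      Nat.card (orthogonalGroup Q) * ∏ i ∈ Finset.Icc 1 j, (Nat.card F ^ i * t + 1) := by
  induction j generalizing t with
  | zero =>
    have h1 : pointwiseStabilizer Q (⊥ : Submodule F V) = ⊤ :=
      eq_top_iff.2 fun g _ => mem_pointwiseStabilizer.2 fun w hw => by
        rw [(Submodule.mem_bot F).1 hw, smul_zero]
    have h0 : ∀ v : Fin 0 → V, Submodule.span F (Set.range v) = ⊥ := fun v => by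
      rw [Set.range_eq_empty, Submodule.span_empty]
    rw [Fintype.sum_unique, h0, h1, finrank_bot]
    simp
  | succ j ih =>
    rw [← (Fin.consEquiv fun _ => V).sum_comp, Fintype.sum_prod_type_right]
    have hstep : ∀ v : Fin j → V, ∑ x : V,
        Nat.card (pointwiseStabilizer Q (Submodule.span F
          (Set.range (Fin.consEquiv (fun _ => V) (x, v))))) *
        t ^ finrank F (Submodule.span F (Set.range (Fin.consEquiv (fun _ => V) (x, v)))) =
        (Nat.card F * t + 1) * (Nat.card (pointwiseStabilizer Q (Submodule.span F (Set.range v))) *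
          (Nat.card F * t) ^ finrank F (Submodule.span F (Set.range v))) := fun v => by
      have hv : finrank F (Submodule.span F (Set.range v)) ≤ j :=
        (finrank_range_le_card v).trans_eq (Fintype.card_fin j)
      rw [← sum_card_pointwiseStabilizer_sup hF hQ (by omega) t]
      refine Finset.sum_congr rfl fun x _ => ?_
      have : Submodule.span F (Set.range (Fin.consEquiv (fun _ => V) (x, v))) =
          Submodule.span F (Set.range v) ⊔ Submodule.span F {x} := by
        change Submodule.span F (Set.range (Fin.cons x v : Fin (j + 1) → V)) = _
        rw [Fin.range_cons, Submodule.span_insert, sup_comm]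
      rw [this]
    -- The induction hypothesis is used at qt: its factors become those of index 2 to j + 1, and qt
    -- + 1 is the one of index 1.
    rw [Finset.sum_congr rfl fun v _ => hstep v, ← Finset.mul_sum, ih (by omega),
      prod_Icc_one_eq_prod_range, prod_Icc_one_eq_prod_range, Finset.prod_range_succ',
      zero_add, pow_one, mul_left_comm, mul_comm (Nat.card F * t + 1)]
    simp only [pow_succ, mul_assoc]

lemma sum_numFixedVectors_pow [Fintype V] [Fintype (orthogonalGroup Q)] (j : ℕ) :
    ∑ g : orthogonalGroup Q, numFixedVectors Q g ^ j =
      ∑ v : Fin j → V, Nat.card (pointwiseStabilizer Q (Submodule.span F (Set.range v))) := by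
  have h1 : ∀ g : orthogonalGroup Q,
      numFixedVectors Q g ^ j = Nat.card {v : Fin j → V // ∀ i, g • v i = v i} := fun g => by
    rw [Nat.card_congr (Equiv.subtypePiEquivPi (p := fun (_ : Fin j) x => g • x = x)),
      Nat.card_pi, Finset.prod_const, Finset.card_univ, Fintype.card_fin]
    rfl
  rw [Finset.sum_congr rfl fun g _ => h1 g, ← Nat.card_sigma, ← Nat.card_sigma]
  have key : ∀ (v : Fin j → V) (g : orthogonalGroup Q),
      g ∈ pointwiseStabilizer Q (Submodule.span F (Set.range v)) ↔ ∀ i, g • v i = v i :=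
    fun v g => by rw [mem_pointwiseStabilizer_span, Set.forall_mem_range]
  exact Nat.card_congr
    { toFun := fun p => ⟨p.2, p.1, (key _ _).2 p.2.2⟩
      invFun := fun p => ⟨p.2, p.1, (key _ _).1 p.2.2⟩
      left_inv := fun _ => rfl
      right_inv := fun _ => rfl }

end Orbits

end FixedVectors

theorem mainTheorem4 {F V : Type*} [Field F] [Finite F] [AddCommGroup V] [Module F V]
    [FiniteDimensional F V] (q : ℕ) (hq : Nat.card F = q) (hodd : Odd q)
    (n : ℕ) (hV : Module.finrank F V = 2 * n + 1)
    (Q : QuadraticForm F V) (hQ : (QuadraticMap.polarBilin Q).Nondegenerate)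
    (j : ℕ) (hj : j ≤ n) :
    FixedVectors.uniformExpectation
        (fun g : FixedVectors.orthogonalGroup Q => (FixedVectors.numFixedVectors Q g : ℝ) ^ j) =
      ∏ i ∈ Finset.Icc 1 j, ((q : ℝ) ^ i + 1) := by
  subst hq
  have : Finite V := Module.finite_of_finite F
  have : Fintype V := Fintype.ofFinite V
  let _ : Fintype (FixedVectors.orthogonalGroup Q) := Fintype.ofFinite _
  have h := FixedVectors.sum_card_pointwiseStabilizer_span_range hodd hQ j (by omega) 1
  simp only [one_pow, mul_one] at h
  rw [← FixedVectors.sum_numFixedVectors_pow, Nat.card_eq_fintype_card] at h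
  have h' := congrArg (Nat.cast : ℕ → ℝ) h
  push_cast at h'
  rw [FixedVectors.uniformExpectation, h', mul_div_cancel_left₀]
  exact Nat.cast_ne_zero.2 Fintype.card_ne_zero
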